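/- Cycles are viewed as sets of edges (of length at least $3$), families are multisets (members may be repeated), $K_m$ is the complete graph on $m$ vertices, and $V(E)$ denotes the set of vertices incident with an edge set $E$. A \emph{rainbow cycle} of a family $\mathcal{O}$ of cycles is a cycle $R$ for which there is an injection $\sigma$ from $R$ to $\mathcal{O}$ (repeated members counting as distinct) with $e\in\sigma(e)$ for every edge $e\in R$. Define recursively: a family $\mathcal{O}$ of cycles is a \emph{pruned cactus} if all its members are identical to a single cycle on $|\mathcal{O}|+1$ vertices, or if $\mathcal{O}$ can be partitioned into two pruned cacti $\mathcal{O}_1,\mathcal{O}_2$ such that $V(\bigcup\mathcal{O}_1)$ and $V(\bigcup\mathcal{O}_2)$ have exactly one vertex in common. A family $\mathcal{O}$ of cycles is a \emph{saguaro} if it is a pruned cactus, or if it can be partitioned into three subfamilies $\mathcal{O}_1,\{O\},\mathcal{O}_2$ such that $\mathcal{O}_1$ and $\mathcal{O}_2$ are saguaros with $V(\bigcup\mathcal{O}_1)\cap V(\bigcup\mathcal{O}_2)=\varnothing$, and $O$ is an even cycle along which the vertices alternate between $V(\bigcup\mathcal{O}_1)$ and $V(\bigcup\mathcal{O}_2)$.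 Theorem. Let $n\ge 1$. A family $\mathcal{O}$ of $n$ cycles in $K_{n+1}$ has no rainbow cycle if and only if $\mathcal{O}$ is a saguaro. -/

import Mathlib

namespace RainbowCycles

variable {V ι : Type*}

/-- A cycle of the complete graph on `V`, viewed as a set of edges. -/
def IsCycleSet (C : Set (Sym2 V)) : Prop :=
  ∃ (v : V) (p : (⊤ : SimpleGraph V).Walk v v), p.IsCycle ∧ C = {e | e ∈ p.edges}

/-- The vertices covered by a set of edges. -/
def verts (E : Set (Sym2 V)) : Set V :=
  {v | ∃ e ∈ E, v ∈ e}

/-- The vertices of the union of the members of the family `O` with index in `s`. -/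
def familyVerts (O : ι → Set (Sym2 V)) (s : Finset ι) : Set V :=
  verts (⋃ i ∈ s, O i)

/-- `R` is a rainbow set of the family `O`. Families are indexed, so that members may be
repeated; distinct elements of `R` are assigned to distinct indices. -/
def IsRainbow {α : Type*} (O : ι → Set α) (R : Set α) : Prop :=
  ∃ σ : R → ι, Function.Injective σ ∧ ∀ e : R, (e : α) ∈ O (σ e)

/-- The family `O` has a rainbow cycle. -/
def HasRainbowCycle (O : ι → Set (Sym2 V)) : Prop :=
  ∃ R : Set (Sym2 V), IsCycleSet R ∧ IsRainbow O R

/-- The subfamily of `O` with index set `s` is a pruned cactus. -/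
inductive IsPrunedCactus [DecidableEq ι] (O : ι → Set (Sym2 V)) : Finset ι → Prop
  | identical (s : Finset ι) (C : Set (Sym2 V)) (hC : IsCycleSet C)
      (hcard : (verts C).ncard = s.card + 1) (heq : ∀ i ∈ s, O i = C) :
      IsPrunedCactus O s
  | glue (s t : Finset ι) (hst : Disjoint s t)
      (hs : IsPrunedCactus O s) (ht : IsPrunedCactus O t)
      (hv : ∃ v : V, familyVerts O s ∩ familyVerts O t = {v}) :
      IsPrunedCactus O (s ∪ t)

/-- The subfamily of `O` with index set `s` is a saguaro. In the second case, the vertices of the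
even cycle `O i` alternate between two disjoint sets: each of its edges joins one to the other. -/
inductive IsSaguaro [DecidableEq ι] (O : ι → Set (Sym2 V)) : Finset ι → Prop
  | cactus (s : Finset ι) (hs : IsPrunedCactus O s) : IsSaguaro O s
  | join (s t : Finset ι) (i : ι) (hst : Disjoint s t) (his : i ∉ s) (hit : i ∉ t)
      (hs : IsSaguaro O s) (ht : IsSaguaro O t)
      (hv : Disjoint (familyVerts O s) (familyVerts O t))
      (hcycle : IsCycleSet (O i)) (heven : Even (O i).ncard)
      (halt : ∀ e ∈ O i, ∃ a ∈ familyVerts O s, ∃ b ∈ familyVerts O t, e = s(a, b)) :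
      IsSaguaro O (insert i (s ∪ t))

end RainbowCycles

namespace RainbowCycles

/-! ### Rainbow circuits over `ZMod 2`: extension of transversals and linear independence. -/

section Binary

variable {ι α W : Type*} [AddCommGroup W]

/-! Over the field with two elements, the incidence vectors of the edges of a cycle sum to zero, and
a rainbow cycle exists exactly when some nonempty partial transversal of the family sums to zero.
With one vertex dropped, incidence vectors on n + 1 vertices live in dimension n, so without a
rainbow cycle every transversal `b` is a basis.

Draw an arc from i to j ≠ i when an element of `O i` off the transversal has nonzero coordinate at
`b j`. Exchanging elements along a chordless directed cycle would create a zero sum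
(`CircuitFree.exchange`), unless members coincide (`CircuitFree.eq_of_mutual`). So either every
member is repeated, as often as its size minus one, or some unrepeated k has no incoming arc; its
coordinate then vanishes on all other members and is 1 on `O k`
(`CircuitFree.exists_cut_or_repeated`).

In a graph such a functional is a cut, and the family splits at `O k` by induction. In the repeated
case the rank bound `RainbowFree.card_lt` forces the blocks to meet in single vertices. Conversely,
an even set meets each cut evenly and decomposes at a cut vertex, so both constructions preserve the
absence of rainbow even sets. -/

/-- No nonempty partial transversal of the family `O` has sum zero. -/
def CircuitFree (O : ι → Finset α) (φ : α → W) : Prop :=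
  ∀ (J : Finset ι) (e : ι → α), J.Nonempty → (∀ i ∈ J, e i ∈ O i) → Set.InjOn e J →
    ∑ i ∈ J, φ (e i) ≠ 0

/-- Greedy choice never gets stuck: if all of `O a` were already used, those elements would be a
partial transversal with sum zero. -/
theorem CircuitFree.exists_transversal [Fintype ι] [DecidableEq ι] [DecidableEq α]
    {O : ι → Finset α} {φ : α → W}
    (hfree : CircuitFree O φ) (hne : ∀ i, (O i).Nonempty) (hsum : ∀ i, ∑ e ∈ O i, φ e = 0)
    (J : Finset ι) (e : ι → α) (hmem : ∀ i ∈ J, e i ∈ O i) (hinj : Set.InjOn e J) :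
    ∃ b : ι → α, (∀ i, b i ∈ O i) ∧ Function.Injective b ∧ ∀ i ∈ J, b i = e i := by
  have key : ∀ K : Finset ι, ∃ b : ι → α, (∀ i ∈ J ∪ K, b i ∈ O i) ∧
      Set.InjOn b (J ∪ K : Finset ι) ∧ ∀ i ∈ J, b i = e i := by
    intro K
    induction K using Finset.induction_on with
    | empty => exact ⟨e, by simpa using hmem, by simpa using hinj, fun _ _ => rfl⟩
    | insert a K haK ih =>
      obtain ⟨b, hb, hbi, hbe⟩ := ih
      by_cases haJ : a ∈ J
      · have : J ∪ insert a K = J ∪ K := by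
          ext x; simp only [Finset.mem_union, Finset.mem_insert]; grind
        rw [this]
        exact ⟨b, hb, hbi, hbe⟩
      have ha : a ∉ J ∪ K := by simp [haJ, haK]
      obtain ⟨x, hx, hxb⟩ : ∃ x ∈ O a, x ∉ (J ∪ K).image b := by
        by_contra! hcon
        set L := (J ∪ K).filter (fun i => b i ∈ O a) with hL
        have hLs : (L : Set ι) ⊆ (J ∪ K : Finset ι) := by
          intro i hi; exact (Finset.mem_filter.1 hi).1
        have himg : L.image b = O a := by
          ext y
          simp only [hL, Finset.mem_image, Finset.mem_filter]
          constructor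
          · rintro ⟨i, ⟨_, h⟩, rfl⟩; exact h
          · intro hy
            obtain ⟨i, hi, rfl⟩ := Finset.mem_image.1 (hcon y hy)
            exact ⟨i, ⟨hi, hy⟩, rfl⟩
        refine hfree L b ?_ (fun i hi => hb i (hLs hi)) (hbi.mono hLs) ?_
        · rw [← Finset.image_nonempty (f := b), himg]; exact hne a
        · rw [← Finset.sum_image (f := φ) (hbi.mono hLs), himg, hsum]
      have hup : ∀ i ∈ J ∪ K, Function.update b a x i = b i := fun i hi =>
        Function.update_of_ne (by rintro rfl; exact ha hi) _ _
      have hins : J ∪ insert a K = insert a (J ∪ K) := by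
        ext y; simp only [Finset.mem_union, Finset.mem_insert]; tauto
      refine ⟨Function.update b a x, ?_, ?_, ?_⟩
      · rw [hins]
        intro i hi
        rcases Finset.mem_insert.1 hi with rfl | hi
        · simpa using hx
        · rw [hup i hi]; exact hb i hi
      · rw [hins, Finset.coe_insert, Set.injOn_insert (by simpa using ha)]
        refine ⟨fun i hi j hj hij => ?_, ?_⟩
        · rw [hup i hi, hup j hj] at hij
          exact hbi hi hj hij
        · rintro ⟨i, hi, hix⟩
          rw [hup i hi, Function.update_self] at hix
          exact hxb (Finset.mem_image.2 ⟨i, hi, hix⟩)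
      · intro i hi
        rw [hup i (Finset.mem_union_left _ hi), hbe i hi]
  obtain ⟨b, hb, hbi, hbe⟩ := key Finset.univ
  refine ⟨b, fun i => hb i (by simp), fun i j hij => hbi (by simp) (by simp) hij, hbe⟩

variable [Module (ZMod 2) W]

theorem zmod_two_eq_one {a : ZMod 2} (h : a ≠ 0) : a = 1 := by
  revert a; decide

theorem CircuitFree.linearIndependent {O : ι → Finset α} {φ : α → W}
    (hfree : CircuitFree O φ) {b : ι → α} (hb : ∀ i, b i ∈ O i) (hbi : Function.Injective b) :
    LinearIndependent (ZMod 2) (fun i => φ (b i)) := by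
  classical
  rw [linearIndependent_iff']
  intro s g hg i hi
  by_contra hgi
  refine hfree (s.filter (fun i => g i ≠ 0)) b ⟨i, by simp [hi, hgi]⟩ (fun i _ => hb i)
    hbi.injOn ?_
  rw [← hg, Finset.sum_filter]
  refine Finset.sum_congr rfl fun j _ => ?_
  by_cases h : g j = 0
  · simp [h]
  · simp [zmod_two_eq_one h]

/-! ### Coordinates with respect to a transversal basis. -/

section Frame

variable [DecidableEq ι]
  {O : ι → Finset α} {φ : α → W} (hfree : CircuitFree O φ)
  (hsum : ∀ i, ∑ e ∈ O i, φ e = 0)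
  {b : ι → α} (hb : ∀ i, b i ∈ O i) (hbi : Function.Injective b)
  (B : Module.Basis ι (ZMod 2) W) (hB : ∀ i, B i = φ (b i))

include hB in
theorem coord_transversal (i j : ι) : B.coord j (φ (b i)) = if i = j then 1 else 0 := by
  rw [← hB, Module.Basis.coord_apply, Module.Basis.repr_self, Finsupp.single_apply]

variable [Fintype ι]

include hfree hb hbi hB in
/-- Replacing the members of a transversal in `J` by others cannot create a dependency. -/
theorem CircuitFree.exchange (J : Finset ι) (hJ : J.Nonempty) (e : ι → α)
    (he : ∀ i ∈ J, e i ∈ O i) (hinj : Set.InjOn e J) (hout : ∀ i ∈ J, ∀ l ∉ J, e i ≠ b l)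
    (hzero : ∀ j ∈ J, ∑ i ∈ J, B.coord j (φ (e i)) = 0) : False := by
  -- The sum `w` of the new elements lies in the span of the `b l` with `l ∉ J`; adding those in its
  -- support gives a zero-sum partial transversal.
  set w := ∑ i ∈ J, φ (e i) with hw
  set K := Finset.univ.filter (fun j => B.coord j w ≠ 0) with hK
  have hKJ : Disjoint J K := by
    rw [Finset.disjoint_left]
    intro j hj hjK
    exact (Finset.mem_filter.1 hjK).2 (by rw [hw, map_sum]; exact hzero j hj)
  have hwK : w = ∑ j ∈ K, φ (b j) := by
    conv_lhs => rw [← B.sum_repr w]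
    rw [hK, Finset.sum_filter]
    refine Finset.sum_congr rfl fun j _ => ?_
    rw [hB, ← Module.Basis.coord_apply]
    by_cases h : B.coord j w = 0
    · simp [h]
    · simp [zmod_two_eq_one h]
  let f : ι → α := fun i => if i ∈ J then e i else b i
  have hfJ : ∀ i ∈ J, f i = e i := fun i hi => if_pos hi
  have hfK : ∀ i, i ∉ J → f i = b i := fun i hi => if_neg hi
  refine hfree (J ∪ K) f (hJ.mono Finset.subset_union_left) ?_ ?_ ?_
  · intro i _
    by_cases hi : i ∈ J
    · rw [hfJ i hi]; exact he i hi
    · rw [hfK i hi]; exact hb i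
  · intro i _ j _ hij
    by_cases hi : i ∈ J <;> by_cases hj : j ∈ J
    · rw [hfJ i hi, hfJ j hj] at hij; exact hinj hi hj hij
    · rw [hfJ i hi, hfK j hj] at hij; exact (hout i hi j hj hij).elim
    · rw [hfK i hi, hfJ j hj] at hij; exact (hout j hj i hi hij.symm).elim
    · rw [hfK i hi, hfK j hj] at hij; exact hbi hij
  · rw [Finset.sum_union hKJ, Finset.sum_congr rfl (fun i hi => by rw [hfJ i hi]),
      Finset.sum_congr (s₁ := K) rfl
        (fun i hi => by rw [hfK i (Finset.disjoint_right.1 hKJ hi)]), ← hwK, ← hw]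
    exact ZModModule.add_self w

include hfree hb hbi hB in
theorem CircuitFree.coord_self {i : ι} {e : α} (he : e ∈ O i) (hne : ∀ l, e ≠ b l) :
    B.coord i (φ e) = 1 := by
  by_contra h
  have h0 : B.coord i (φ e) = 0 := by
    by_contra h0; exact h (zmod_two_eq_one h0)
  exact hfree.exchange hb hbi B hB {i} ⟨i, by simp⟩ (fun _ => e) (by simpa using he)
    (by simp) (fun _ _ l _ => hne l) (by simpa using h0)

-- Equal coordinates at i and j cancel in pairs. The new elements may be `b i` or `b j` themselves,
-- which allows `b i` to move from `O i` to `O j`.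
include hfree hb hbi hB in
theorem CircuitFree.exchange_pair {i j : ι} (hij : i ≠ j) {e f : α} (he : e ∈ O i) (hf : f ∈ O j)
    (hef : e ≠ f) (heb : ∀ l, l ≠ i → l ≠ j → e ≠ b l) (hfb : ∀ l, l ≠ i → l ≠ j → f ≠ b l)
    (hi : B.coord i (φ e) = B.coord i (φ f)) (hj : B.coord j (φ e) = B.coord j (φ f)) :
    False := by
  have h2 : ∀ x : ZMod 2, x + x = 0 := by decide
  refine hfree.exchange hb hbi B hB {i, j} ⟨i, by simp⟩ (fun l => if l = i then e else f)
    ?_ ?_ ?_ ?_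
  · intro l hl
    rcases Finset.mem_insert.1 hl with rfl | hl
    · simpa using he
    · rw [Finset.mem_singleton.1 hl]; simpa [hij.symm] using hf
  · intro k hk l hl hkl
    simp only [Finset.coe_insert, Finset.coe_singleton, Set.mem_insert_iff,
      Set.mem_singleton_iff] at hk hl
    rcases hk with rfl | rfl <;> rcases hl with rfl | rfl <;> simp_all [hij.symm]
  · intro k _ l hl
    simp only [Finset.mem_insert, Finset.mem_singleton, not_or] at hl
    split_ifs
    · exact heb l hl.1 hl.2
    · exact hfb l hl.1 hl.2
  · intro l hl
    rw [Finset.sum_pair hij]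
    simp only [if_true, hij.symm, if_false]
    rcases Finset.mem_insert.1 hl with rfl | hl
    · rw [hi, h2]
    · rw [Finset.mem_singleton.1 hl, hj, h2]

-- Otherwise `f` could represent `O i` while `b i` represents `O j`: both would have coordinates 1
-- at i and 0 at j.
include hfree hb hbi hB in
theorem CircuitFree.coord_of_mem {i j : ι} (hij : i ≠ j) (hbj : b i ∈ O j) {f : α}
    (hf : f ∈ O i) (hfb : ∀ l, f ≠ b l) : B.coord j (φ f) = 1 := by
  by_contra h
  have h0 : B.coord j (φ f) = 0 := by
    by_contra h0; exact h (zmod_two_eq_one h0)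
  refine hfree.exchange_pair hb hbi B hB hij hf hbj (hfb i) (fun l _ _ => hfb l)
    (fun l hl _ h => hl (hbi h).symm) ?_ ?_
  · rw [hfree.coord_self hb hbi B hB hf hfb, coord_transversal B hB, if_pos rfl]
  · rw [h0, coord_transversal B hB, if_neg hij]

include hfree hb hbi hB in
theorem CircuitFree.eq_of_coord {i j : ι} (hij : i ≠ j) {e f : α} (he : e ∈ O i)
    (heb : ∀ l, e ≠ b l) (hf : f ∈ O j) (hfb : ∀ l, f ≠ b l)
    (hej : B.coord j (φ e) = 1) (hfi : B.coord i (φ f) = 1) : e = f := by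
  by_contra hef
  refine hfree.exchange_pair hb hbi B hB hij he hf hef (fun l _ _ => heb l) (fun l _ _ => hfb l)
    ?_ ?_
  · rw [hfi, hfree.coord_self hb hbi B hB he heb]
  · rw [hej, hfree.coord_self hb hbi B hB hf hfb]

variable [DecidableEq α]

-- Coordinate j of the relation `hsum i`: among the transversal elements only `b j` contributes.
include hsum hB hbi in
theorem sum_coord_offTransversal (i j : ι) :
    ∑ e ∈ O i with ∀ l, e ≠ b l, B.coord j (φ e) = if b j ∈ O i then 1 else 0 := by
  have h := congrArg (B.coord j) (hsum i)
  rw [map_sum, map_zero, ← Finset.sum_filter_add_sum_filter_not (O i) (fun e => ∀ l, e ≠ b l)] at h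
  have h2 : ∑ e ∈ O i with ¬ ∀ l, e ≠ b l, B.coord j (φ e) = if b j ∈ O i then 1 else 0 := by
    have : ∀ e ∈ (O i).filter (fun e => ¬ ∀ l, e ≠ b l),
        B.coord j (φ e) = if e = b j then 1 else 0 := by
      intro e he
      obtain ⟨l, hl⟩ := not_forall.1 (Finset.mem_filter.1 he).2
      rw [not_not.1 hl, coord_transversal B hB]
      simp only [hbi.eq_iff]
    rw [Finset.sum_congr rfl this, Finset.sum_ite_eq']
    congr 1
    simp only [Finset.mem_filter, eq_iff_iff, and_iff_left_iff_imp]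
    intro _ h
    exact h j rfl
  rw [h2] at h
  have h3 : ∀ x y : ZMod 2, x + y = 0 → x = y := by decide
  exact h3 _ _ h

include hsum hB hbi in
theorem mem_iff_coord_of_unique {i : ι} {e : α}
    (hu : ∀ f, (f ∈ O i ∧ ∀ l, f ≠ b l) ↔ f = e) (j : ι) :
    b j ∈ O i ↔ B.coord j (φ e) = 1 := by
  have h := sum_coord_offTransversal hsum hbi B hB i j
  have : (O i).filter (fun f => ∀ l, f ≠ b l) = {e} := by
    ext f; simp [hu]
  rw [this, Finset.sum_singleton] at h
  rw [h]
  split_ifs with hh <;> simp [hh]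

include hfree hsum hb hbi hB in
/-- Members whose off-transversal elements use each other's coordinates are equal. -/
theorem CircuitFree.eq_of_mutual {i j : ι} (hij : i ≠ j) {e f : α} (he : e ∈ O i)
    (heb : ∀ l, e ≠ b l) (hf : f ∈ O j) (hfb : ∀ l, f ≠ b l)
    (hej : B.coord j (φ e) = 1) (hfi : B.coord i (φ f) = 1) :
    O i = O j ∧ ∀ x, (x ∈ O i ∧ ∀ l, x ≠ b l) ↔ x = e := by
  have main : ∀ {i j : ι} {e f : α}, i ≠ j → e ∈ O i → (∀ l, e ≠ b l) → f ∈ O j →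
      (∀ l, f ≠ b l) → B.coord j (φ e) = 1 → B.coord i (φ f) = 1 →
      ∀ x, (x ∈ O i ∧ ∀ l, x ≠ b l) ↔ x = e := by
    intro i j e f hij he heb hf hfb hej hfi
    -- By `eq_of_coord`, `f` is the only off-transversal element of `O j` with coordinate 1 at i, so
    -- the coordinate sum is odd.
    have hbij : b i ∈ O j := by
      by_contra hcon
      have h := sum_coord_offTransversal hsum hbi B hB j i
      rw [if_neg hcon, Finset.sum_eq_single f] at h
      · rw [hfi] at h; exact one_ne_zero h
      · intro x hx hxf
        rw [Finset.mem_filter] at hx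
        by_contra h0
        have hx1 := zmod_two_eq_one h0
        exact hxf ((hfree.eq_of_coord hb hbi B hB hij he heb hx.1 hx.2 hej hx1).symm.trans
          (hfree.eq_of_coord hb hbi B hB hij he heb hf hfb hej hfi))
      · intro h; exact (h (Finset.mem_filter.2 ⟨hf, hfb⟩)).elim
    intro x
    constructor
    · rintro ⟨hx, hxb⟩
      have hxj := hfree.coord_of_mem hb hbi B hB hij hbij hx hxb
      exact (hfree.eq_of_coord hb hbi B hB hij hx hxb hf hfb hxj hfi).trans
        (hfree.eq_of_coord hb hbi B hB hij he heb hf hfb hej hfi).symm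
    · rintro rfl; exact ⟨he, heb⟩
  have hi := main hij he heb hf hfb hej hfi
  have hj := main hij.symm hf hfb he heb hfi hej
  have hef := hfree.eq_of_coord hb hbi B hB hij he heb hf hfb hej hfi
  subst hef
  refine ⟨?_, hi⟩
  ext x
  by_cases hx : ∀ l, x ≠ b l
  · have h1 := hi x
    have h2 := hj x
    simp only [hx, implies_true, ne_eq, not_false_eq_true, and_true] at h1 h2
    rw [h1, h2]
  · push Not at hx
    obtain ⟨l, rfl⟩ := hx
    rw [mem_iff_coord_of_unique hsum hbi B hB hi, mem_iff_coord_of_unique hsum hbi B hB hj]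

include hsum hB hbi in
theorem exists_offTransversal {i j : ι} (h : b j ∈ O i) :
    ∃ e ∈ O i, (∀ l, e ≠ b l) ∧ B.coord j (φ e) = 1 := by
  have hs := sum_coord_offTransversal hsum hbi B hB i j
  rw [if_pos h] at hs
  obtain ⟨e, he, hne⟩ := Finset.exists_ne_zero_of_sum_ne_zero (hs ▸ one_ne_zero)
  rw [Finset.mem_filter] at he
  exact ⟨e, he.1, he.2, zmod_two_eq_one hne⟩

include hfree hsum hb hbi hB in
theorem CircuitFree.eq_of_mem {i j : ι} (hij : i ≠ j) (hbj : b i ∈ O j) :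
    O i = O j ∧ ∃ e, ∀ x, (x ∈ O i ∧ ∀ l, x ≠ b l) ↔ x = e := by
  obtain ⟨f, hf, hfb, hfi⟩ := exists_offTransversal hsum hbi B hB hbj
  obtain ⟨e, he, heb, _⟩ := exists_offTransversal hsum hbi B hB (hb i)
  have := hfree.eq_of_mutual hsum hb hbi B hB hij he heb hf hfb
    (hfree.coord_of_mem hb hbi B hB hij hbj he heb) hfi
  exact ⟨this.1, e, this.2⟩

include hfree hsum hb hbi hB in
/-- A repeated member is repeated as often as its rank. -/
theorem CircuitFree.card_of_repeated {i j : ι} (hij : i ≠ j) (hO : O i = O j) :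
    (O i).card = (Finset.univ.filter (fun l => O l = O i)).card + 1 ∧
    ∃ e, (∀ x, (x ∈ O i ∧ ∀ l, x ≠ b l) ↔ x = e) ∧
      ∀ l, B.coord l (φ e) = 1 → O l = O i := by
  obtain ⟨-, e, he⟩ := hfree.eq_of_mem hsum hb hbi B hB hij (hO ▸ hb i)
  have hmem : ∀ l, b l ∈ O i ↔ O l = O i := by
    intro l
    constructor
    · intro h
      by_cases hl : l = i
      · rw [hl]
      · exact (hfree.eq_of_mem hsum hb hbi B hB hl h).1
    · intro h; rw [← h]; exact hb l
  refine ⟨?_, e, he, fun l hl =>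
    (hmem l).1 ((mem_iff_coord_of_unique hsum hbi B hB he l).2 hl)⟩
  -- The copies contribute one transversal element each; the single off-transversal element is the
  -- extra one.
  have hOi : O i = insert e ((Finset.univ.filter (fun l => O l = O i)).image b) := by
    ext x
    simp only [Finset.mem_insert, Finset.mem_image, Finset.mem_filter, Finset.mem_univ, true_and]
    constructor
    · intro hx
      by_cases hxb : ∀ l, x ≠ b l
      · exact Or.inl ((he x).1 ⟨hx, hxb⟩)
      · push Not at hxb
        obtain ⟨l, rfl⟩ := hxb
        exact Or.inr ⟨l, (hmem l).1 hx, rfl⟩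
    · rintro (rfl | ⟨l, hl, rfl⟩)
      · exact ((he x).2 rfl).1
      · exact (hmem l).2 hl
  have hnot : e ∉ (Finset.univ.filter (fun l => O l = O i)).image b := by
    intro h
    obtain ⟨l, _, hl⟩ := Finset.mem_image.1 h
    exact ((he e).2 rfl).2 l hl.symm
  conv_lhs => rw [hOi]
  rw [Finset.card_insert_of_notMem hnot, Finset.card_image_of_injective _ hbi]

end Frame

/-- A finite nonempty set without sources contains a chordless directed cycle. -/
theorem exists_chordless_cycle {ι : Type*} [DecidableEq ι] (r : ι → ι → Prop) (P : Finset ι)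
    (hP : P.Nonempty) (hpred : ∀ j ∈ P, ∃ i ∈ P, r i j) :
    ∃ J ⊆ P, J.Nonempty ∧ (∀ j ∈ J, ∃! i, i ∈ J ∧ r i j) ∧ (∀ i ∈ J, ∃! j, j ∈ J ∧ r i j) := by
  -- In a smallest source-free set, the image of any choice of predecessors is again source-free, so
  -- every such choice is a permutation.
  obtain ⟨J, ⟨hJP, hJ, hJp⟩, hmin⟩ := Set.Finite.exists_minimalFor Finset.card
    {J : Finset ι | J ⊆ P ∧ J.Nonempty ∧ ∀ j ∈ J, ∃ i ∈ J, r i j}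
    (P.powerset.finite_toSet.subset (fun J hJ => by simpa using hJ.1)) ⟨P, subset_rfl, hP, hpred⟩
  have hinj : ∀ g : ι → ι, (∀ j ∈ J, g j ∈ J ∧ r (g j) j) →
      J.image g = J ∧ Set.InjOn g J := by
    intro g hg
    have hsub : J.image g ⊆ J := by
      intro x hx
      obtain ⟨j, hj, rfl⟩ := Finset.mem_image.1 hx
      exact (hg j hj).1
    have hcard : J.card ≤ (J.image g).card := by
      refine hmin ⟨hsub.trans hJP, hJ.image g, ?_⟩ (Finset.card_le_card hsub)
      intro j hj
      exact ⟨g j, Finset.mem_image_of_mem g (hsub hj), (hg j (hsub hj)).2⟩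
    have heq := Finset.eq_of_subset_of_card_le hsub hcard
    refine ⟨heq, Finset.injOn_of_card_image_eq (by rw [heq])⟩
  have hex : ∀ j, ∃ i, j ∈ J → i ∈ J ∧ r i j := by
    intro j
    by_cases hj : j ∈ J
    · obtain ⟨i, hi⟩ := hJp j hj
      exact ⟨i, fun _ => hi⟩
    · exact ⟨j, fun h => (hj h).elim⟩
  choose g hg using hex
  obtain ⟨himg, hgi⟩ := hinj g hg
  have huniq : ∀ j ∈ J, ∀ i ∈ J, r i j → i = g j := by
    intro j hj i hi hij
    by_contra hne
    -- Redirecting j to a second predecessor i gives another choice, yet i is already the value at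
    -- some other l, against injectivity.
    have hup : ∀ l ∈ J, Function.update g j i l ∈ J ∧ r (Function.update g j i l) l := by
      intro l hl
      by_cases hlj : l = j
      · subst hlj; simpa using ⟨hi, hij⟩
      · rw [Function.update_of_ne hlj]; exact hg l hl
    obtain ⟨-, hui⟩ := hinj _ hup
    rw [← himg] at hi
    obtain ⟨l, hl, rfl⟩ := Finset.mem_image.1 hi
    have hlj : l ≠ j := by rintro rfl; exact hne rfl
    exact hlj (hui hl hj (by rw [Function.update_of_ne hlj, Function.update_self]))
  refine ⟨J, hJP, hJ, fun j hj => ⟨g j, hg j hj, fun i hi => huniq j hj i hi.1 hi.2⟩, ?_⟩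
  intro i hi
  rw [← himg] at hi
  obtain ⟨j, hj, rfl⟩ := Finset.mem_image.1 hi
  refine ⟨j, ⟨hj, (hg j hj).2⟩, ?_⟩
  rintro l ⟨hl, hrl⟩
  exact hgi hl hj (huniq l hl _ (hg j hj).1 hrl).symm

/-- A family of zero-sum sets without rainbow circuits, as many as the rank, has a member that is
a cut separating all others, or consists of repeated members only. -/
theorem CircuitFree.exists_cut_or_repeated [Fintype ι] [DecidableEq ι] [DecidableEq α]
    {O : ι → Finset α} {φ : α → W}
    (hfree : CircuitFree O φ) (hne : ∀ i, (O i).Nonempty) (hsum : ∀ i, ∑ e ∈ O i, φ e = 0)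
    (hdim : Module.finrank (ZMod 2) W = Fintype.card ι) :
    (∃ (k : ι) (c : W →ₗ[ZMod 2] ZMod 2), (∀ i ≠ k, ∀ e ∈ O i, c (φ e) = 0) ∧
      ∀ e ∈ O k, c (φ e) = 1) ∨
    ∀ i, (O i).card = (Finset.univ.filter (fun l => O l = O i)).card + 1 := by
  rcases isEmpty_or_nonempty ι with hι | hι
  · exact Or.inr fun i => (hι.false i).elim
  have hbasis : ∀ b : ι → α, (∀ i, b i ∈ O i) → Function.Injective b →
      ∃ B : Module.Basis ι (ZMod 2) W, ∀ i, B i = φ (b i) := fun b hb hbi =>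
    ⟨basisOfLinearIndependentOfCardEqFinrank (hfree.linearIndependent hb hbi) hdim.symm,
      fun i => by simp⟩
  obtain ⟨b, hb, hbi, -⟩ := hfree.exists_transversal hne hsum ∅ (fun i => (hne i).choose)
    (by simp) (by simp)
  obtain ⟨B, hB⟩ := hbasis b hb hbi
  set P := Finset.univ.filter (fun k => ∀ j, k ≠ j → O k ≠ O j) with hP
  rcases P.eq_empty_or_nonempty with hPe | hPne
  · right
    intro i
    have hi : i ∉ P := by rw [hPe]; simp
    simp only [hP, Finset.mem_filter, Finset.mem_univ, true_and, not_forall, not_not] at hi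
    obtain ⟨j, hij, hO⟩ := hi
    exact (hfree.card_of_repeated hsum hb hbi B hB hij hO).1
  left
  let r : ι → ι → Prop := fun i j => i ≠ j ∧ ∃ e ∈ O i, (∀ l, e ≠ b l) ∧ B.coord j (φ e) = 1
  obtain ⟨k, hkP, hk⟩ : ∃ k ∈ P, ∀ i, ¬ r i k := by
    by_contra! hcon
    -- Predecessors of unrepeated indices are unrepeated: a repeated member only involves the
    -- coordinates of its own copies.
    obtain ⟨J, hJP, hJ, hpred, hsucc⟩ := exists_chordless_cycle r P hPne (by
      intro j hj
      obtain ⟨i, hij⟩ := hcon j hj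
      refine ⟨i, ?_, hij⟩
      simp only [hP, Finset.mem_filter, Finset.mem_univ, true_and] at hj ⊢
      intro l hil hO
      obtain ⟨-, e, he, hel⟩ := hfree.card_of_repeated hsum hb hbi B hB hil hO
      obtain ⟨hne', x, hx, hxb, hxj⟩ := hij
      rw [(he x).1 ⟨hx, hxb⟩] at hxj
      exact hj i hne'.symm (hel j hxj))
    have hex : ∀ i, ∃ e, i ∈ J → e ∈ O i ∧ (∀ l, e ≠ b l) ∧
        ∀ j ∈ J, r i j → B.coord j (φ e) = 1 := by
      intro i
      by_cases hi : i ∈ J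
      · obtain ⟨j, ⟨hj, hij⟩, hu⟩ := hsucc i hi
        obtain ⟨-, e, he, heb, hej⟩ := hij
        refine ⟨e, fun _ => ⟨he, heb, fun l hl hil => ?_⟩⟩
        rw [hu l ⟨hl, hil⟩]; exact hej
      · exact ⟨b i, fun h => (hi h).elim⟩
    choose e he using hex
    refine hfree.exchange hb hbi B hB J hJ e (fun i hi => (he i hi).1) ?_
      (fun i hi l _ => (he i hi).2.1 l) ?_
    · intro i hi j hj hij
      by_contra hne'
      have hiP := hJP hi
      simp only [hP, Finset.mem_filter, Finset.mem_univ, true_and] at hiP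
      refine hiP j hne' (hfree.eq_of_mutual hsum hb hbi B hB hne' (he i hi).1 (he i hi).2.1
        (he j hj).1 (he j hj).2.1 ?_ ?_).1
      · rw [hij]; exact hfree.coord_self hb hbi B hB (he j hj).1 (he j hj).2.1
      · rw [← hij]; exact hfree.coord_self hb hbi B hB (he i hi).1 (he i hi).2.1
    · intro j hj
      obtain ⟨i, ⟨hi, hij⟩, hu⟩ := hpred j hj
      have hsub : ({i, j} : Finset ι) ⊆ J := by
        intro x hx
        rcases Finset.mem_insert.1 hx with rfl | hx
        · exact hi
        · rw [Finset.mem_singleton.1 hx]; exact hj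
      -- Coordinate j receives exactly two ones, from j itself and from its unique predecessor on
      -- the cycle.
      rw [← Finset.sum_subset hsub, Finset.sum_pair hij.1, (he i hi).2.2 j hj hij,
        hfree.coord_self hb hbi B hB (he j hj).1 (he j hj).2.1]
      · decide
      · intro l hl hlij
        simp only [Finset.mem_insert, Finset.mem_singleton, not_or] at hlij
        by_contra h0
        exact hlij.1 (hu l ⟨hl, hlij.2, e l, (he l hl).1, (he l hl).2.1,
          zmod_two_eq_one h0⟩)
  have hzero : ∀ i ≠ k, ∀ e ∈ O i, B.coord k (φ e) = 0 := by
    intro i hik e he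
    by_contra h0
    by_cases heb : ∀ l, e ≠ b l
    · exact hk i ⟨hik, e, he, heb, zmod_two_eq_one h0⟩
    · push Not at heb
      obtain ⟨l, rfl⟩ := heb
      rw [coord_transversal B hB] at h0
      have hlk : l = k := by by_contra h; simp [h] at h0
      subst hlk
      obtain ⟨f, hf⟩ := exists_offTransversal hsum hbi B hB he
      exact hk i ⟨hik, f, hf⟩
  refine ⟨k, B.coord k, hzero, ?_⟩
  intro e he
  -- A transversal through `e` is also a basis; were coordinate k zero at `e`, it would vanish on
  -- this whole basis.
  obtain ⟨b', hb', hbi', hbe⟩ := hfree.exists_transversal hne hsum {k} (fun _ => e)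
    (by simpa using he) (by simp)
  obtain ⟨B', hB'⟩ := hbasis b' hb' hbi'
  by_contra h
  have h0 : B.coord k (φ e) = 0 := by
    by_contra h0; exact h (zmod_two_eq_one h0)
  have : B.coord k = 0 := by
    refine B'.ext fun i => ?_
    rw [hB', LinearMap.zero_apply]
    by_cases hik : i = k
    · rw [hik, hbe k (by simp)]; exact h0
    · exact hzero i hik _ (hb' i)
  have h1 := coord_transversal B hB k k
  rw [this, if_pos rfl, LinearMap.zero_apply] at h1
  exact zero_ne_one h1

end Binary

end RainbowCycles

namespace RainbowCycles

/-! ### Cycles, cuts and even edge sets. -/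

section Graph

/-- The coboundary modulo two of a vertex function. -/
def coboundary {V : Type*} (p : V → ZMod 2) : Sym2 V → ZMod 2 :=
  Sym2.lift ⟨fun a b => p a + p b, fun a b => add_comm (p a) (p b)⟩

@[simp]
theorem coboundary_mk {V : Type*} (p : V → ZMod 2) (a b : V) :
    coboundary p s(a, b) = p a + p b := rfl

/-- A set of edges in which all degrees are even, expressed by duality. -/
def EvenSet {V : Type*} (R : Finset (Sym2 V)) : Prop :=
  ∀ p : V → ZMod 2, ∑ e ∈ R, coboundary p e = 0

variable {V : Type*}

theorem coboundary_eq_zero_of_const (p : V → ZMod 2) (c : ZMod 2) {e : Sym2 V}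
    (h : ∀ x ∈ e, p x = c) : coboundary p e = 0 := by
  induction e with
  | h a b =>
    rw [coboundary_mk, h a (by simp), h b (by simp)]
    exact ZModModule.add_self c

theorem coboundary_congr {p q : V → ZMod 2} {e : Sym2 V}
    (h : ∀ x ∈ e, p x = q x) : coboundary p e = coboundary q e := by
  induction e with
  | h a b => rw [coboundary_mk, coboundary_mk, h a (by simp), h b (by simp)]

theorem sum_coboundary_edges {G : SimpleGraph V} (p : V → ZMod 2) {u v : V} (w : G.Walk u v) :
    (w.edges.map (coboundary p)).sum = p u + p v := by
  induction w with
  | nil => simpa using (ZModModule.add_self _).symm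
  | cons h q ih =>
    rw [SimpleGraph.Walk.edges_cons, List.map_cons, List.sum_cons, ih, coboundary_mk]
    have : ∀ a b c : ZMod 2, a + b + (b + c) = a + c := by decide
    exact this _ _ _

theorem IsCycleSet.evenSet {R : Finset (Sym2 V)} (h : IsCycleSet (R : Set (Sym2 V))) :
    EvenSet R := by
  classical
  obtain ⟨v, w, hw, hR⟩ := h
  intro p
  have : R = w.edges.toFinset := by
    ext e
    rw [← Finset.mem_coe, hR]
    simp
  rw [this, List.sum_toFinset _ hw.1.1.edges_nodup, sum_coboundary_edges]
  exact ZModModule.add_self _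

theorem IsCycleSet.finite {C : Set (Sym2 V)} (h : IsCycleSet C) : C.Finite := by
  obtain ⟨v, w, hw, rfl⟩ := h
  exact w.edges.finite_toSet

theorem IsCycleSet.nonempty {C : Set (Sym2 V)} (h : IsCycleSet C) : C.Nonempty := by
  obtain ⟨v, w, hw, rfl⟩ := h
  cases w with
  | nil => exact (hw.ne_nil rfl).elim
  | @cons _ u _ h q => exact ⟨s(v, u), by simp⟩

theorem IsCycleSet.not_isDiag {C : Set (Sym2 V)} (h : IsCycleSet C) {e : Sym2 V} (he : e ∈ C) :
    ¬ e.IsDiag := by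
  obtain ⟨v, w, hw, rfl⟩ := h
  exact SimpleGraph.not_isDiag_of_mem_edgeSet _ (w.edges_subset_edgeSet he)

/-- Connectedness: a cycle with no edge in a cut stays on one side of it. -/
theorem IsCycleSet.eq_of_coboundary_eq_zero {C : Set (Sym2 V)} (h : IsCycleSet C)
    (q : V → ZMod 2) (hq : ∀ e ∈ C, coboundary q e = 0) {x y : V} (hx : x ∈ verts C)
    (hy : y ∈ verts C) : q x = q y := by
  obtain ⟨v, w, hw, rfl⟩ := h
  have key : ∀ {a b : V} (w : (⊤ : SimpleGraph V).Walk a b),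
      (∀ e ∈ w.edges, coboundary q e = 0) → ∀ z ∈ w.support, q z = q a := by
    intro a b w
    induction w with
    | nil => simp
    | @cons a c _ h r ih =>
      intro hr z hz
      rw [SimpleGraph.Walk.support_cons, List.mem_cons] at hz
      rcases hz with rfl | hz
      · rfl
      · rw [ih (fun e he => hr e (by simp [he])) z hz]
        have h0 := hr s(a, c) (by simp)
        rw [coboundary_mk] at h0
        have : ∀ a b : ZMod 2, a + b = 0 → b = a := by decide
        exact this _ _ h0
  have hsupp : ∀ z ∈ verts {e | e ∈ w.edges}, z ∈ w.support := by
    rintro z ⟨e, he, hz⟩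
    exact w.mem_support_of_mem_edges he hz
  rw [key w hq x (hsupp x hx), key w hq y (hsupp y hy)]

theorem IsCycleSet.ncard_verts {C : Set (Sym2 V)} (h : IsCycleSet C) :
    (verts C).ncard = C.ncard := by
  classical
  obtain ⟨v, w, hw, rfl⟩ := h
  cases w with
  | nil => exact (hw.ne_nil rfl).elim
  | @cons _ u _ hadj q =>
    have hE : {e | e ∈ (SimpleGraph.Walk.cons hadj q).edges} =
        ((SimpleGraph.Walk.cons hadj q).edges.toFinset : Set (Sym2 V)) := by
      ext; simp
    have hV : verts {e | e ∈ (SimpleGraph.Walk.cons hadj q).edges} =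
        (q.support.toFinset : Set V) := by
      ext x
      have hnil : ¬ (SimpleGraph.Walk.cons hadj q).Nil := by simp
      have h1 := SimpleGraph.Walk.mem_support_iff_exists_mem_edges_of_not_nil (w := x) hnil
      have h2 : x ∈ (SimpleGraph.Walk.cons hadj q).support ↔ x ∈ q.support := by
        rw [SimpleGraph.Walk.support_cons, List.mem_cons]
        constructor
        · rintro (rfl | h)
          · exact q.end_mem_support
          · exact h
        · exact Or.inr
      rw [List.coe_toFinset, Set.mem_ofPred_eq, ← h2, h1]
      rfl
    have hq := ((SimpleGraph.Walk.cons_isCycle_iff q hadj).1 hw).1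
    rw [hV, hE, Set.ncard_coe_finset, Set.ncard_coe_finset,
      List.toFinset_card_of_nodup hq.support_nodup,
      List.toFinset_card_of_nodup hw.1.1.edges_nodup, SimpleGraph.Walk.length_support,
      SimpleGraph.Walk.length_edges, SimpleGraph.Walk.length_cons]

theorem EvenSet.exists_cycle {R : Finset (Sym2 V)} (h : EvenSet R) (hne : R.Nonempty)
    (hdiag : ∀ e ∈ R, ¬ e.IsDiag) : ∃ C : Set (Sym2 V), C ⊆ R ∧ IsCycleSet C := by
  classical
  set G := SimpleGraph.fromEdgeSet (R : Set (Sym2 V)) with hG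
  have hedge : G.edgeSet = R := by
    rw [hG, SimpleGraph.edgeSet_fromEdgeSet]
    ext e
    simp only [Set.mem_sdiff, Finset.mem_coe]
    exact ⟨fun h => h.1, fun h => ⟨h, hdiag e h⟩⟩
  by_cases hac : G.IsAcyclic
  · exfalso
    obtain ⟨e, he⟩ := hne
    have hbr := SimpleGraph.isAcyclic_iff_forall_isBridge.1 hac (e := e) (by rw [hedge]; exact he)
    induction e with
    | h a b =>
      rw [SimpleGraph.isBridge_iff] at hbr
      -- The component of `a` after deleting the bridge defines a cut that contains no other edge of
      -- `R`.
      let p : V → ZMod 2 := fun x => if (G.deleteEdges {s(a, b)}).Reachable a x then 1 else 0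
      have hp := h p
      rw [Finset.sum_eq_single_of_mem s(a, b) he] at hp
      · simp [p, hbr] at hp
      · intro f hf hne
        induction f with
        | h c d =>
          have hadj : (G.deleteEdges {s(a, b)}).Adj c d := by
            rw [SimpleGraph.deleteEdges_adj]
            refine ⟨?_, by simpa using hne⟩
            rw [← SimpleGraph.mem_edgeSet, hedge]; exact hf
          have : p c = p d := by
            have hiff : (G.deleteEdges {s(a, b)}).Reachable a c ↔
                (G.deleteEdges {s(a, b)}).Reachable a d :=
              ⟨fun h => h.trans hadj.reachable, fun h => h.trans hadj.symm.reachable⟩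
            simp only [p, hiff]
          rw [coboundary_mk, this]
          exact ZModModule.add_self _
  · simp only [SimpleGraph.IsAcyclic, not_forall, not_not] at hac
    obtain ⟨v, w, hw⟩ := hac
    refine ⟨{e | e ∈ w.edges}, fun e he => ?_, v, w.mapLe le_top, ?_, ?_⟩
    · rw [← hedge]; exact w.edges_subset_edgeSet he
    · exact hw.mapLe le_top
    · simp

theorem EvenSet.eq_empty_of_subset_path [DecidableEq V] {G : SimpleGraph V} {u v : V}
    (w : G.Walk u v) (hw : w.IsPath) {R : Finset (Sym2 V)} (hR : EvenSet R)
    (hsub : ∀ e ∈ R, e ∈ w.edges) : R = ∅ := by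
  induction w with
  | nil => exact Finset.eq_empty_of_forall_notMem fun e he => by simpa using hsub e he
  | @cons a b c hadj q ih =>
    rw [SimpleGraph.Walk.cons_isPath_iff] at hw
    refine ih hw.1 fun e he => ?_
    have hmem := hsub e he
    rw [SimpleGraph.Walk.edges_cons, List.mem_cons] at hmem
    rcases hmem with rfl | hmem
    · exfalso
      have hp := hR (Pi.single a 1)
      rw [Finset.sum_eq_single_of_mem _ he] at hp
      · simp [hadj.ne] at hp
      · intro f hf hne
        refine coboundary_eq_zero_of_const _ 0 fun x hx => ?_
        have hfq : f ∈ q.edges := by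
          have := hsub f hf
          rw [SimpleGraph.Walk.edges_cons, List.mem_cons] at this
          exact this.resolve_left hne
        refine Pi.single_eq_of_ne ?_ _
        rintro rfl
        exact hw.2 (q.mem_support_of_mem_edges hfq hx)
    · exact hmem

/-- Deleting one edge of the cycle leaves a path, which contains `R` or its complement in `C`; both
are even, and a path has no nonempty even subset. -/
theorem EvenSet.eq_of_subset_cycle [DecidableEq V] {C R : Finset (Sym2 V)}
    (hC : IsCycleSet (C : Set (Sym2 V)))
    (hR : EvenSet R) (hne : R.Nonempty) (hsub : R ⊆ C) : R = C := by
  have hCe := hC.evenSet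
  have hdiff : EvenSet (C \ R) := by
    intro p
    have := Finset.sum_sdiff (f := coboundary p) hsub
    rwa [hR p, hCe p, add_zero] at this
  obtain ⟨v, w, hw, hCw⟩ := hC
  have hCw' : ∀ e ∈ C, e ∈ w.edges := fun e he => by
    have : e ∈ (C : Set (Sym2 V)) := he
    rw [hCw] at this
    exact this
  cases w with
  | nil => exact (hw.ne_nil rfl).elim
  | @cons _ u _ hadj q =>
    have hq := ((SimpleGraph.Walk.cons_isCycle_iff q hadj).1 hw).1
    have aux : ∀ S ⊆ C, s(v, u) ∉ S → ∀ e ∈ S, e ∈ q.edges := by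
      intro S hS hnot e he
      have := hCw' e (hS he)
      rw [SimpleGraph.Walk.edges_cons, List.mem_cons] at this
      exact this.resolve_left (by rintro rfl; exact hnot he)
    by_cases h : s(v, u) ∈ R
    · have := hdiff.eq_empty_of_subset_path q hq
        (aux _ Finset.sdiff_subset (by simp [h]))
      exact hsub.antisymm (Finset.sdiff_eq_empty_iff_subset.1 this)
    · have := hR.eq_empty_of_subset_path q hq (aux _ hsub h)
      exact (hne.ne_empty this).elim

theorem EvenSet.not_star [DecidableEq V] {C : Finset (Sym2 V)} (hC : EvenSet C)
    (hne : C.Nonempty) (hdiag : ∀ e ∈ C, ¬ e.IsDiag) (x : V) : ∃ e ∈ C, x ∉ e := by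
  by_contra! hx
  obtain ⟨e, he⟩ := hne
  obtain ⟨y, rfl⟩ := Sym2.mem_iff_exists.1 (hx e he)
  have hxy : x ≠ y := by simpa using hdiag _ he
  have hp := hC (Pi.single y 1)
  rw [Finset.sum_eq_single_of_mem _ he] at hp
  · simp [hxy] at hp
  · intro f hf hfe
    obtain ⟨z, rfl⟩ := Sym2.mem_iff_exists.1 (hx f hf)
    have hzy : z ≠ y := by rintro rfl; exact hfe rfl
    simp [hxy, hzy]

theorem EvenSet.filter {R : Finset (Sym2 V)} (hR : EvenSet R) (P : Sym2 V → Prop)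
    [DecidablePred P] {X Y : Set V} (v : V) (hXY : X ∩ Y ⊆ {v})
    (hX : ∀ e ∈ R, P e → ∀ x ∈ e, x ∈ X) (hY : ∀ e ∈ R, ¬ P e → ∀ x ∈ e, x ∈ Y) :
    EvenSet (R.filter P) := by
  classical
  intro p
  -- Making `p` constant outside `X` keeps its coboundary on edges inside `X` and kills it on edges
  -- inside `Y`, which meet `X` at most in `v`.
  have h := hR (fun x => if x ∈ X then p x else p v)
  rw [← h, Finset.sum_filter]
  refine Finset.sum_congr rfl fun e he => ?_
  split_ifs with hP
  · exact coboundary_congr fun x hx => by simp [hX e he hP x hx]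
  · symm
    refine coboundary_eq_zero_of_const _ (p v) fun x hx => ?_
    split_ifs with hxX
    · rw [Set.mem_singleton_iff.1 (hXY ⟨hxX, hY e he hP x hx⟩)]
    · rfl

end Graph

/-! ### Saguaros have no rainbow even set; incidence vectors and the rank bound. -/

section Rainbow

variable {V ι : Type*}

/-- The subfamily of `O` with index set `s` has no nonempty rainbow even set. -/
def RainbowFree (O : ι → Set (Sym2 V)) (s : Finset ι) : Prop :=
  ∀ (R : Finset (Sym2 V)) (σ : Sym2 V → ι), R.Nonempty → Set.InjOn σ R →
    (∀ e ∈ R, σ e ∈ s ∧ e ∈ O (σ e)) → ¬ EvenSet R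

theorem RainbowFree.mono {O : ι → Set (Sym2 V)} {s t : Finset ι} (h : RainbowFree O t)
    (hst : s ⊆ t) : RainbowFree O s := fun R σ hne hσ hR =>
  h R σ hne hσ fun e he => ⟨hst (hR e he).1, (hR e he).2⟩

/-- Even sets make the condition linear; nothing is lost, since a nonempty loopless even set
contains a cycle, which inherits the assignment. -/
theorem not_hasRainbowCycle_iff [Fintype ι] {O : ι → Set (Sym2 V)} (hO : ∀ i, IsCycleSet (O i)) :
    ¬ HasRainbowCycle O ↔ RainbowFree O Finset.univ := by
  classical
  constructor
  · intro h R σ hne hσ hR hev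
    obtain ⟨C, hCR, hC⟩ := hev.exists_cycle hne fun e he => (hO _).not_isDiag (hR e he).2
    exact h ⟨C, hC, fun e => σ e, fun e f hef => Subtype.ext (hσ (hCR e.2) (hCR f.2) hef),
      fun e => (hR e (hCR e.2)).2⟩
  · rintro h ⟨C, hC, σ, hσ, hmem⟩
    obtain ⟨R, rfl⟩ : ∃ R : Finset (Sym2 V), (R : Set (Sym2 V)) = C :=
      ⟨hC.finite.toFinset, by simp⟩
    obtain ⟨e₀, he₀⟩ := hC.nonempty
    have hσ' : ∀ e (he : e ∈ R),
        (fun e => if he : e ∈ R then σ ⟨e, he⟩ else σ ⟨e₀, he₀⟩) e = σ ⟨e, he⟩ :=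
      fun e he => dif_pos he
    refine h R (fun e => if he : e ∈ R then σ ⟨e, he⟩ else σ ⟨e₀, he₀⟩) ⟨e₀, he₀⟩ ?_ ?_ hC.evenSet
    · intro e he f hf hef
      rw [hσ' e he, hσ' f hf] at hef
      exact congrArg Subtype.val (hσ hef)
    · intro e he
      rw [dif_pos he]
      exact ⟨Finset.mem_univ _, hmem _⟩

theorem mem_familyVerts {O : ι → Set (Sym2 V)} {s : Finset ι} {x : V} :
    x ∈ familyVerts O s ↔ ∃ i ∈ s, ∃ e ∈ O i, x ∈ e := by
  simp only [familyVerts, verts, Set.mem_iUnion, Set.mem_ofPred_eq]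
  constructor
  · rintro ⟨e, ⟨i, hi, he⟩, hx⟩; exact ⟨i, hi, e, he, hx⟩
  · rintro ⟨i, hi, e, he, hx⟩; exact ⟨e, ⟨i, hi, he⟩, hx⟩

theorem RainbowFree.union [DecidableEq ι] {O : ι → Set (Sym2 V)} {s t : Finset ι}
    (hs : RainbowFree O s) (ht : RainbowFree O t) (v : V)
    (hv : familyVerts O s ∩ familyVerts O t ⊆ {v}) : RainbowFree O (s ∪ t) := by
  classical
  intro R σ hne hσ hR hev
  have hX : ∀ e ∈ R, σ e ∈ s → ∀ x ∈ e, x ∈ familyVerts O s := fun e he h x hx =>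
    mem_familyVerts.2 ⟨_, h, e, (hR e he).2, hx⟩
  have hst : ∀ e ∈ R, σ e ∉ s → σ e ∈ t := fun e he h =>
    (Finset.mem_union.1 (hR e he).1).resolve_left h
  have hY : ∀ e ∈ R, σ e ∉ s → ∀ x ∈ e, x ∈ familyVerts O t := fun e he h x hx =>
    mem_familyVerts.2 ⟨_, hst e he h, e, (hR e he).2, hx⟩
  have hs' := hev.filter (fun e => σ e ∈ s) v hv hX hY
  have ht' := hev.filter (fun e => σ e ∉ s) v (by rwa [Set.inter_comm]) hY
    (fun e he h => hX e he (not_not.1 h))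
  have hsub : ∀ (P : Sym2 V → Prop) [DecidablePred P], (R.filter P : Set (Sym2 V)) ⊆ R := fun P _ e he =>
    (Finset.mem_filter.1 he).1
  rcases (R.filter (fun e => σ e ∈ s)).eq_empty_or_nonempty with h | h
  · rw [Finset.filter_eq_empty_iff] at h
    refine ht (R.filter fun e => σ e ∉ s) σ ?_ (hσ.mono (hsub _)) ?_ ?_
    · obtain ⟨e, he⟩ := hne
      exact ⟨e, Finset.mem_filter.2 ⟨he, h he⟩⟩
    · intro e he
      rw [Finset.mem_filter] at he
      exact ⟨hst e he.1 he.2, (hR e he.1).2⟩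
    · convert ht'
  · refine hs _ σ h (hσ.mono (hsub _)) ?_ hs'
    intro e he
    rw [Finset.mem_filter] at he
    exact ⟨he.2, (hR e he.1).2⟩

theorem IsPrunedCactus.rainbowFree [DecidableEq ι] {O : ι → Set (Sym2 V)} {s : Finset ι}
    (h : IsPrunedCactus O s) : RainbowFree O s := by
  classical
  induction h with
  | identical s C hC hcard heq =>
    intro R σ hne hσ hR hev
    obtain ⟨D, rfl⟩ : ∃ D : Finset (Sym2 V), (D : Set (Sym2 V)) = C :=
      ⟨hC.finite.toFinset, by simp⟩
    have hsub : R ⊆ D := fun e he => by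
      have := (hR e he).2
      rwa [heq _ (hR e he).1] at this
    have hRD := hev.eq_of_subset_cycle hC hne hsub
    -- A rainbow even set would be all of `C`, with one edge more than there are indices.
    have hle := Finset.card_le_card_of_injOn σ (fun e he => (hR e he).1) hσ
    rw [hC.ncard_verts, Set.ncard_coe_finset, ← hRD] at hcard
    omega
  | glue s t hst hs ht hv ihs iht =>
    obtain ⟨v, hv⟩ := hv
    exact ihs.union iht v hv.subset

theorem IsSaguaro.rainbowFree [DecidableEq ι] {O : ι → Set (Sym2 V)} {s : Finset ι}
    (h : IsSaguaro O s) : RainbowFree O s := by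
  classical
  induction h with
  | cactus s hs => exact hs.rainbowFree
  | join s t i hst his hit hs ht hv hcycle heven halt ihs iht =>
    intro R σ hne hσ hR hev
    obtain ⟨e, he⟩ := hne
    -- Only an edge assigned to `i` can cross between the two sides, and there is at most one such
    -- edge, while an even set crosses evenly.
    have hσi : ∀ e ∈ R, σ e ≠ i := by
      intro e he hei
      let p : V → ZMod 2 := fun x => if x ∈ familyVerts O s then 1 else 0
      have hp := hev p
      rw [Finset.sum_eq_single_of_mem e he] at hp
      · obtain ⟨a, ha, b, hb, rfl⟩ := halt e (hei ▸ (hR e he).2)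
        have hb' : b ∉ familyVerts O s := fun h => Set.disjoint_left.1 hv h hb
        simp [p, ha, hb'] at hp
      · intro f hf hfe
        have hfi : σ f ≠ i := fun h => hfe (hσ hf he (h.trans hei.symm))
        have hfst := (Finset.mem_insert.1 (hR f hf).1).resolve_left hfi
        rcases Finset.mem_union.1 hfst with h | h
        · refine coboundary_eq_zero_of_const _ 1 fun x hx => if_pos ?_
          exact mem_familyVerts.2 ⟨_, h, f, (hR f hf).2, hx⟩
        · refine coboundary_eq_zero_of_const _ 0 fun x hx => if_neg ?_
          exact Set.disjoint_right.1 hv (mem_familyVerts.2 ⟨_, h, f, (hR f hf).2, hx⟩)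
    induction e with
    | h a b =>
      refine ihs.union iht a ?_ R σ ⟨_, he⟩ hσ (fun f hf => ⟨?_, (hR f hf).2⟩) hev
      · rw [hv.inter_eq]; exact Set.empty_subset _
      · exact (Finset.mem_insert.1 (hR f hf).1).resolve_left (hσi f hf)

/-- The incidence vector of an edge, restricted to the vertices of `A` other than `r`. -/
def incidence [DecidableEq V] (A : Finset V) (r : V) (e : Sym2 V) : ↥(A.erase r) → ZMod 2 :=
  fun x => coboundary (Pi.single (x : V) 1) e

theorem sum_mul_incidence [DecidableEq V] (A : Finset V) (r : V) (g : ↥(A.erase r) → ZMod 2)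
    (e : Sym2 V) : ∑ x, g x * incidence A r e x =
      coboundary (fun a => if h : a ∈ A.erase r then g ⟨a, h⟩ else 0) e := by
  have key : ∀ a, ∑ x : ↥(A.erase r), g x * (Pi.single (x : V) 1 : V → ZMod 2) a =
      if h : a ∈ A.erase r then g ⟨a, h⟩ else 0 := by
    intro a
    split_ifs with h
    · rw [Finset.sum_eq_single ⟨a, h⟩]
      · simp
      · intro x _ hx
        rw [Pi.single_eq_of_ne, mul_zero]
        rintro rfl; exact hx rfl
      · simp
    · refine Finset.sum_eq_zero fun x _ => ?_
      rw [Pi.single_eq_of_ne, mul_zero]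
      rintro rfl; exact h x.2
  induction e with
  | h a b =>
    simp only [incidence, coboundary_mk, mul_add, Finset.sum_add_distrib, key]

/-- Adding the constant `p r` leaves the coboundary unchanged and makes the function vanish at `r`,
so dropping `r` loses no information. -/
theorem coboundary_eq_sum_incidence [DecidableEq V] {A : Finset V} {r : V} (p : V → ZMod 2)
    {e : Sym2 V} (he : ∀ x ∈ e, x ∈ A) :
    coboundary p e = ∑ x : ↥(A.erase r), (p x + p r) * incidence A r e x := by
  rw [sum_mul_incidence]
  have : coboundary p e = coboundary (fun x => p x + p r) e := by
    induction e with
    | h a b =>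
      rw [coboundary_mk, coboundary_mk]
      generalize p a = x; generalize p b = y; generalize p r = z
      revert x y z; decide
  rw [this]
  refine coboundary_congr fun x hx => ?_
  split_ifs with h
  · rfl
  · rw [Finset.mem_erase, not_and] at h
    have hxr : x = r := by by_contra hne; exact h hne (he x hx)
    rw [hxr]; exact ZModModule.add_self _

theorem evenSet_of_sum_incidence [DecidableEq V] {A : Finset V} {r : V} {R : Finset (Sym2 V)}
    (hA : ∀ e ∈ R, ∀ x ∈ e, x ∈ A) (h : ∑ e ∈ R, incidence A r e = 0) : EvenSet R := by
  intro p
  rw [Finset.sum_congr rfl fun e he => coboundary_eq_sum_incidence (r := r) p (hA e he),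
    Finset.sum_comm]
  refine Finset.sum_eq_zero fun x _ => ?_
  have hx := congrFun h x
  rw [Finset.sum_apply] at hx
  rw [← Finset.mul_sum, hx, Pi.zero_apply, mul_zero]

theorem EvenSet.sum_incidence [DecidableEq V] {R : Finset (Sym2 V)} (h : EvenSet R)
    (A : Finset V) (r : V) : ∑ e ∈ R, incidence A r e = 0 := by
  funext x
  rw [Finset.sum_apply]
  exact h _

theorem finrank_incidence [DecidableEq V] {A : Finset V} {r : V} (hr : r ∈ A) :
    Module.finrank (ZMod 2) (↥(A.erase r) → ZMod 2) + 1 = A.card := by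
  rw [Module.finrank_fintype_fun_eq_card, Fintype.card_coe, Finset.card_erase_add_one hr]

variable {F : ι → Finset (Sym2 V)} {s : Finset ι} {A : Finset V}

theorem RainbowFree.circuitFree [DecidableEq V]
    (h : RainbowFree (fun i => (F i : Set (Sym2 V))) s)
    (hA : ∀ i ∈ s, ∀ e ∈ F i, ∀ x ∈ e, x ∈ A) (r : V) :
    CircuitFree (fun i : s => F i) (incidence A r) := by
  intro J e hJ he hinj hsum
  have : Nonempty s := ⟨hJ.choose⟩
  have hinv : ∀ i ∈ J, Function.invFunOn e J (e i) = i := fun i hi =>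
    hinj.leftInvOn_invFunOn hi
  refine h (J.image e) (fun x => (Function.invFunOn e J x : s)) (hJ.image e) ?_ ?_ ?_
  · intro x hx y hy hxy
    obtain ⟨i, hi, rfl⟩ := Finset.mem_image.1 hx
    obtain ⟨j, hj, rfl⟩ := Finset.mem_image.1 hy
    have := Subtype.ext hxy
    rw [hinv i hi, hinv j hj] at this
    rw [this]
  · intro x hx
    obtain ⟨i, hi, rfl⟩ := Finset.mem_image.1 hx
    dsimp only
    rw [hinv i hi]
    exact ⟨i.2, he i hi⟩
  · refine evenSet_of_sum_incidence (A := A) (r := r) ?_ ?_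
    · intro x hx
      obtain ⟨i, hi, rfl⟩ := Finset.mem_image.1 hx
      exact hA i i.2 _ (he i hi)
    · rw [Finset.sum_image hinj]; exact hsum

/-- A transversal is linearly independent in a space of dimension `A.card - 1`. -/
theorem RainbowFree.card_lt [DecidableEq V] [DecidableEq ι]
    (h : RainbowFree (fun i => (F i : Set (Sym2 V))) s)
    (hF : ∀ i, IsCycleSet (F i : Set (Sym2 V)))
    (hA : ∀ i ∈ s, ∀ e ∈ F i, ∀ x ∈ e, x ∈ A) (hne : A.Nonempty) : s.card + 1 ≤ A.card := by
  obtain ⟨r, hr⟩ := hne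
  have hfree := h.circuitFree hA r
  obtain ⟨b, hb, hbi, -⟩ := hfree.exists_transversal (fun i => (hF i).nonempty)
    (fun i => (hF i).evenSet.sum_incidence A r) ∅ (fun i => (hF i).nonempty.choose)
    (by simp) (by simp)
  have := (hfree.linearIndependent hb hbi).fintype_card_le_finrank
  rw [Fintype.card_coe] at this
  have h2 := finrank_incidence hr
  omega

end Rainbow

end RainbowCycles

namespace RainbowCycles

/-! ### Families that attain the rank bound are saguaros. -/

section Structure

variable {V ι : Type*} {F : ι → Finset (Sym2 V)}

theorem finite_familyVerts [DecidableEq V] (F : ι → Finset (Sym2 V)) (s : Finset ι) :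
    (familyVerts (fun i => (F i : Set (Sym2 V))) s).Finite := by
  have : familyVerts (fun i => (F i : Set (Sym2 V))) s =
      ((s.biUnion F).biUnion fun e => e.toFinset : Finset V) := by
    ext x
    rw [mem_familyVerts]
    simp only [Finset.mem_coe, Finset.mem_biUnion, Sym2.mem_toFinset]
    constructor
    · rintro ⟨i, hi, e, he, hx⟩; exact ⟨e, ⟨i, hi, he⟩, hx⟩
    · rintro ⟨e, ⟨i, hi, he⟩, hx⟩; exact ⟨i, hi, e, he, hx⟩
  rw [this]
  exact Finset.finite_toSet _

theorem familyVerts_nonempty (hF : ∀ i, IsCycleSet (F i : Set (Sym2 V))) {s : Finset ι}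
    (hs : s.Nonempty) : (familyVerts (fun i => (F i : Set (Sym2 V))) s).Nonempty := by
  obtain ⟨i, hi⟩ := hs
  obtain ⟨e, he⟩ := (hF i).nonempty
  induction e with
  | h a b => exact ⟨a, mem_familyVerts.2 ⟨i, hi, _, he, by simp⟩⟩

variable [DecidableEq V] [DecidableEq ι]

theorem RainbowFree.card_lt_ncard (hF : ∀ i, IsCycleSet (F i : Set (Sym2 V))) {s : Finset ι}
    (h : RainbowFree (fun i => (F i : Set (Sym2 V))) s) (hs : s.Nonempty) :
    s.card + 1 ≤ (familyVerts (fun i => (F i : Set (Sym2 V))) s).ncard := by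
  have hfin := finite_familyVerts F s
  have hne := familyVerts_nonempty hF hs
  obtain ⟨A, hA⟩ := hfin.exists_finset_coe
  rw [← hA] at hne ⊢
  rw [Set.ncard_coe_finset]
  refine h.card_lt hF (fun i hi e he x hx => ?_) (by simpa using hne)
  rw [← Finset.mem_coe, hA]
  exact mem_familyVerts.2 ⟨i, hi, e, he, hx⟩

theorem RainbowFree.familyVerts_eq (hF : ∀ i, IsCycleSet (F i : Set (Sym2 V))) {s : Finset ι}
    (h : RainbowFree (fun i => (F i : Set (Sym2 V))) s) (hs : s.Nonempty) {A : Finset V}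
    (hA : ∀ i ∈ s, ∀ e ∈ F i, ∀ x ∈ e, x ∈ A) (hcard : A.card = s.card + 1) :
    familyVerts (fun i => (F i : Set (Sym2 V))) s = A := by
  refine Set.eq_of_subset_of_ncard_le ?_ ?_ A.finite_toSet
  · intro x hx
    obtain ⟨i, hi, e, he, hxe⟩ := mem_familyVerts.1 hx
    exact hA i hi e he x hxe
  · rw [Set.ncard_coe_finset, hcard]
    exact h.card_lt_ncard hF hs

theorem RainbowFree.isPrunedCactus (hF : ∀ i, IsCycleSet (F i : Set (Sym2 V))) {s : Finset ι}
    (h : RainbowFree (fun i => (F i : Set (Sym2 V))) s) (hs : s.Nonempty) {A : Finset V}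
    (hA : ∀ i ∈ s, ∀ e ∈ F i, ∀ x ∈ e, x ∈ A) (hcard : A.card = s.card + 1)
    (hrep : ∀ i ∈ s, (F i).card = (s.filter (fun l => F l = F i)).card + 1) :
    IsPrunedCactus (fun i => (F i : Set (Sym2 V))) s := by
  set O : ι → Set (Sym2 V) := fun i => (F i : Set (Sym2 V)) with hO
  have hblockverts : ∀ i ∈ s, familyVerts O (s.filter (fun l => F l = F i)) = verts (O i) := by
    intro i hi
    ext x
    rw [mem_familyVerts]
    constructor
    · rintro ⟨l, hl, e, he, hx⟩
      have := (Finset.mem_filter.1 hl).2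
      exact ⟨e, by rw [hO] at he ⊢; simpa [this] using he, hx⟩
    · rintro ⟨e, he, hx⟩
      exact ⟨i, by simp [hi], e, he, hx⟩
  have hblockcard : ∀ i ∈ s, (verts (O i)).ncard = (s.filter (fun l => F l = F i)).card + 1 := by
    intro i hi
    rw [(hF i).ncard_verts, Set.ncard_coe_finset, hrep i hi]
  have hblock : ∀ i ∈ s, IsPrunedCactus O (s.filter (fun l => F l = F i)) := by
    intro i hi
    refine .identical _ (O i) (hF i) (hblockcard i hi) fun l hl => ?_
    simp only [hO, (Finset.mem_filter.1 hl).2]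
  obtain ⟨i₀, hi₀⟩ := hs
  -- A block is a class of equal members; `U` is a largest pruned cactus that is a union of blocks
  -- and attains the rank bound.
  obtain ⟨U, ⟨hUs, hUc, hUv, hUcl, hUne⟩, hmax⟩ := Set.Finite.exists_maximalFor Finset.card
    {U : Finset ι | U ⊆ s ∧ IsPrunedCactus O U ∧ (familyVerts O U).ncard = U.card + 1 ∧
      (∀ i ∈ U, s.filter (fun l => F l = F i) ⊆ U) ∧ U.Nonempty}
    (s.powerset.finite_toSet.subset (fun J hJ => by simpa using hJ.1))
    ⟨s.filter (fun l => F l = F i₀), Finset.filter_subset _ _, hblock i₀ hi₀,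
      by rw [hblockverts i₀ hi₀, hblockcard i₀ hi₀], fun i hi => by
        rw [(Finset.mem_filter.1 hi).2], ⟨i₀, by simp [hi₀]⟩⟩
  by_cases hUeq : U = s
  · exact hUeq ▸ hUc
  exfalso
  obtain ⟨X, hX⟩ := (finite_familyVerts F U).exists_finset_coe
  have hXcard : X.card = U.card + 1 := by rw [← hUv, ← Set.ncard_coe_finset, hX]
  have hXA : X ⊆ A := by
    intro x hx
    rw [← Finset.mem_coe, hX] at hx
    obtain ⟨i, hi, e, he, hxe⟩ := mem_familyVerts.1 hx
    exact hA i (hUs hi) e he x hxe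
  obtain ⟨j, hj⟩ : (s \ U).Nonempty := by
    rw [Finset.sdiff_nonempty]
    exact fun h => hUeq (hUs.antisymm h)
  -- Otherwise the remaining members would live on only as many vertices as there are members,
  -- against the rank bound.
  obtain ⟨i, hi, hmeet⟩ : ∃ i ∈ s \ U, (familyVerts O U ∩ verts (O i)).Nonempty := by
    by_contra! hcon
    have hAX : ∀ i ∈ s \ U, ∀ e ∈ F i, ∀ x ∈ e, x ∈ A \ X := by
      intro i hi e he x hx
      refine Finset.mem_sdiff.2 ⟨hA i (Finset.mem_sdiff.1 hi).1 e he x hx, fun hxX => ?_⟩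
      rw [← Finset.mem_coe, hX] at hxX
      exact Set.eq_empty_iff_forall_notMem.1 (hcon i hi) x ⟨hxX, e, he, hx⟩
    have hne : (A \ X).Nonempty := by
      obtain ⟨x, hx⟩ := familyVerts_nonempty hF (s := {j}) (by simp)
      obtain ⟨i, hi, e, he, hxe⟩ := mem_familyVerts.1 hx
      rw [Finset.mem_singleton.1 hi] at he
      exact ⟨x, hAX j hj e he x hxe⟩
    have h1 := (h.mono (Finset.sdiff_subset (t := U))).card_lt hF hAX hne
    rw [Finset.card_sdiff_of_subset hXA, Finset.card_sdiff_of_subset hUs, hcard, hXcard] at h1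
    have := Finset.card_le_card hUs
    have h3 := Finset.card_pos.2 ⟨j, hj⟩
    rw [Finset.card_sdiff_of_subset hUs] at h3
    omega
  obtain ⟨his, hiU⟩ := Finset.mem_sdiff.1 hi
  set D := s.filter (fun l => F l = F i) with hD
  have hDs : D ⊆ s := Finset.filter_subset _ _
  have hiD : i ∈ D := by simp [hD, his]
  have hdisj : Disjoint U D := by
    rw [Finset.disjoint_left]
    intro l hl hlD
    refine hiU (hUcl l hl (Finset.mem_filter.2 ⟨his, (Finset.mem_filter.1 hlD).2.symm⟩))
  rw [← hblockverts i his] at hmeet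
  have hDv : (familyVerts O D).ncard = D.card + 1 := by
    rw [hblockverts i his, hblockcard i his]
  have hunion : familyVerts O (U ∪ D) = familyVerts O U ∪ familyVerts O D := by
    ext x
    simp only [mem_familyVerts, Set.mem_union, Finset.mem_union, or_and_right, exists_or]
  have hbound := (h.mono (Finset.union_subset hUs hDs)).card_lt_ncard hF ⟨i, by simp [hiD]⟩
  have hie := Set.ncard_union_add_ncard_inter (familyVerts O U) (familyVerts O D)
    (finite_familyVerts F U) (finite_familyVerts F D)
  have hpos : 0 < (familyVerts O U ∩ familyVerts O D).ncard :=
    (Set.ncard_pos ((finite_familyVerts F U).inter_of_left _)).2 hmeet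
  have hUDcard := Finset.card_union_of_disjoint hdisj
  change _ ≤ (familyVerts O (U ∪ D)).ncard at hbound
  rw [hunion] at hbound
  -- Two common vertices would leave `U ∪ D` with too few vertices for its rank.
  have hone : (familyVerts O U ∩ familyVerts O D).ncard = 1 := by omega
  have hmem : U ∪ D ∈ {U : Finset ι | U ⊆ s ∧ IsPrunedCactus O U ∧
      (familyVerts O U).ncard = U.card + 1 ∧
      (∀ i ∈ U, s.filter (fun l => F l = F i) ⊆ U) ∧ U.Nonempty} := by
    refine ⟨Finset.union_subset hUs hDs, .glue U D hdisj hUc (hblock i his)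
      (Set.ncard_eq_one.1 hone), by rw [hunion]; omega, ?_, hUne.mono Finset.subset_union_left⟩
    intro l hl
    rcases Finset.mem_union.1 hl with hl | hl
    · exact (hUcl l hl).trans Finset.subset_union_left
    · rw [(Finset.mem_filter.1 hl).2]; exact Finset.subset_union_right
  have := hmax hmem (Finset.card_le_card Finset.subset_union_left)
  have hDpos := Finset.card_pos.2 ⟨i, hiD⟩
  omega

/-- If one member of a family is contained in a cut disjoint from all other members, the family
splits along the cut. -/
theorem RainbowFree.isSaguaro_of_cut (hF : ∀ i, IsCycleSet (F i : Set (Sym2 V))) {s : Finset ι}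
    (h : RainbowFree (fun i => (F i : Set (Sym2 V))) s) {A : Finset V}
    (hA : ∀ i ∈ s, ∀ e ∈ F i, ∀ x ∈ e, x ∈ A) (hcard : A.card = s.card + 1)
    {k : ι} (hk : k ∈ s) (q : V → ZMod 2)
    (hq : ∀ i ∈ s, i ≠ k → ∀ e ∈ F i, coboundary q e = 0)
    (hqk : ∀ e ∈ F k, coboundary q e = 1)
    (ih : ∀ (t : Finset ι) (B : Finset V), t ⊆ s → t.card < s.card → t.Nonempty →
      (∀ i ∈ t, ∀ e ∈ F i, ∀ x ∈ e, x ∈ B) → B.card = t.card + 1 →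
      IsSaguaro (fun i => (F i : Set (Sym2 V))) t) :
    IsSaguaro (fun i => (F i : Set (Sym2 V))) s := by
  set X := A.filter (fun x => q x = 1) with hX
  set Y := A.filter (fun x => ¬ q x = 1) with hY
  set P : ι → Prop := fun i => ∃ x ∈ verts (F i : Set (Sym2 V)), q x = 1 with hP
  classical
  set s₁ := (s.erase k).filter P with hs₁
  set s₂ := (s.erase k).filter (fun i => ¬ P i) with hs₂
  have hone : ∀ x y : ZMod 2, x + y = 1 → x = 1 ∧ ¬ y = 1 ∨ ¬ x = 1 ∧ y = 1 := by decide
  have hcross : ∀ e ∈ F k, ∃ a ∈ X, ∃ b ∈ Y, e = s(a, b) := by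
    intro e he
    have hA' := hA k hk e he
    have hqe := hqk e he
    induction e with
    | h a b =>
      have ha := hA' a (by simp)
      have hb := hA' b (by simp)
      rcases hone _ _ hqe with h | h
      · exact ⟨a, by simp [hX, ha, h], b, by simp [hY, hb, h], rfl⟩
      · exact ⟨b, by simp [hX, hb, h], a, by simp [hY, ha, h], Sym2.eq_swap⟩
  have hsub₁ : s₁ ⊆ s := (Finset.filter_subset _ _).trans (Finset.erase_subset _ _)
  have hsub₂ : s₂ ⊆ s := (Finset.filter_subset _ _).trans (Finset.erase_subset _ _)
  have hA₁ : ∀ i ∈ s₁, ∀ e ∈ F i, ∀ x ∈ e, x ∈ X := by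
    intro i hi e he x hx
    obtain ⟨hik, y, hy, hqy⟩ := Finset.mem_filter.1 hi
    have hik' := Finset.mem_erase.1 hik
    refine Finset.mem_filter.2 ⟨hA i hik'.2 e he x hx, ?_⟩
    rw [← hqy]
    exact (hF i).eq_of_coboundary_eq_zero q (hq i hik'.2 hik'.1) ⟨e, he, hx⟩ hy
  have hA₂ : ∀ i ∈ s₂, ∀ e ∈ F i, ∀ x ∈ e, x ∈ Y := by
    intro i hi e he x hx
    obtain ⟨hik, hnot⟩ := Finset.mem_filter.1 hi
    exact Finset.mem_filter.2 ⟨hA i (Finset.mem_erase.1 hik).2 e he x hx,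
      fun hqx => hnot ⟨x, ⟨e, he, hx⟩, hqx⟩⟩
  obtain ⟨e₀, he₀⟩ := (hF k).nonempty
  obtain ⟨a₀, ha₀, b₀, hb₀, -⟩ := hcross e₀ he₀
  -- The rank bounds on the two sides add up to `A.card`, so both are attained and induction applies
  -- to each side.
  have h₁ := (h.mono hsub₁).card_lt hF hA₁ ⟨a₀, ha₀⟩
  have h₂ := (h.mono hsub₂).card_lt hF hA₂ ⟨b₀, hb₀⟩
  have hXY : X.card + Y.card = A.card := Finset.card_filter_add_card_filter_not _
  have hss : s₁.card + s₂.card + 1 = s.card := by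
    rw [hs₁, hs₂, Finset.card_filter_add_card_filter_not, Finset.card_erase_add_one hk]
  have hdiag : ∀ e ∈ F k, ¬ e.IsDiag := fun e he => (hF k).not_isDiag he
  have hkne : (F k).Nonempty := ⟨e₀, he₀⟩
  -- An empty side would have a single vertex, making the cycle `F k` a star.
  have hne₁ : s₁.Nonempty := by
    rw [← Finset.card_pos]
    by_contra h0
    obtain ⟨x, hx⟩ := Finset.card_eq_one.1 (show X.card = 1 by omega)
    obtain ⟨e, he, hxe⟩ := (hF k).evenSet.not_star hkne hdiag x
    obtain ⟨a, ha, b, hb, rfl⟩ := hcross e he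
    rw [hx, Finset.mem_singleton] at ha
    exact hxe (by simp [ha])
  have hne₂ : s₂.Nonempty := by
    rw [← Finset.card_pos]
    by_contra h0
    obtain ⟨x, hx⟩ := Finset.card_eq_one.1 (show Y.card = 1 by omega)
    obtain ⟨e, he, hxe⟩ := (hF k).evenSet.not_star hkne hdiag x
    obtain ⟨a, ha, b, hb, rfl⟩ := hcross e he
    rw [hx, Finset.mem_singleton] at hb
    exact hxe (by simp [hb])
  have hv₁ := (h.mono hsub₁).familyVerts_eq hF hne₁ hA₁ (by omega)
  have hv₂ := (h.mono hsub₂).familyVerts_eq hF hne₂ hA₂ (by omega)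
  have hs : s = insert k (s₁ ∪ s₂) := by
    rw [hs₁, hs₂, Finset.filter_union_filter_not_eq, Finset.insert_erase hk]
  have hsag₁ := ih s₁ X hsub₁ (by omega) hne₁ hA₁ (by omega)
  have hsag₂ := ih s₂ Y hsub₂ (by omega) hne₂ hA₂ (by omega)
  rw [hs]
  refine .join s₁ s₂ k ?_ ?_ ?_ hsag₁ hsag₂ ?_ (hF k) ?_ ?_
  · exact Finset.disjoint_filter_filter_not _ _ _
  · simp [hs₁]
  · simp [hs₂]
  · rw [hv₁, hv₂, Finset.disjoint_coe]
    exact Finset.disjoint_filter_filter_not _ _ _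
  · rw [Set.ncard_coe_finset, ← ZMod.natCast_eq_zero_iff_even]
    have := (hF k).evenSet q
    rw [Finset.sum_congr rfl hqk] at this
    simpa using this
  · rw [hv₁, hv₂]
    exact hcross

theorem RainbowFree.isSaguaro (hF : ∀ i, IsCycleSet (F i : Set (Sym2 V))) :
    ∀ (s : Finset ι) (A : Finset V), RainbowFree (fun i => (F i : Set (Sym2 V))) s →
      s.Nonempty → (∀ i ∈ s, ∀ e ∈ F i, ∀ x ∈ e, x ∈ A) → A.card = s.card + 1 →
      IsSaguaro (fun i => (F i : Set (Sym2 V))) s := by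
  intro s
  induction hn : s.card using Nat.strong_induction_on generalizing s with
  | _ n ih =>
  subst hn
  intro A h hs hA hcard
  obtain ⟨r, hr⟩ : A.Nonempty := Finset.card_pos.1 (by omega)
  have hdim : Module.finrank (ZMod 2) (↥(A.erase r) → ZMod 2) = Fintype.card s := by
    have := finrank_incidence hr
    rw [Fintype.card_coe]; omega
  rcases (h.circuitFree hA r).exists_cut_or_repeated (fun i => (hF i).nonempty)
    (fun i => (hF i).evenSet.sum_incidence A r) hdim with ⟨k, c, hc, hck⟩ | hrep
  -- The values of `c` on unit vectors, extended by 0 at `r`, give a vertex function whose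
  -- coboundary is `c`.
  · set q : V → ZMod 2 := fun a => if h : a ∈ A.erase r then c (Pi.single ⟨a, h⟩ 1) else 0
    have hqc : ∀ e, c (incidence A r e) = coboundary q e := by
      intro e
      rw [LinearMap.pi_apply_eq_sum_univ, ← sum_mul_incidence A r (fun x => c (Pi.single x 1)) e]
      refine Finset.sum_congr rfl fun x _ => ?_
      rw [smul_eq_mul, mul_comm]
      congr 2
      funext y
      simp [Pi.single_apply, eq_comm]
    refine h.isSaguaro_of_cut hF hA hcard k.2 q ?_ ?_ ?_
    · intro i hi hik e he
      rw [← hqc]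
      exact hc ⟨i, hi⟩ (fun h => hik (congrArg Subtype.val h)) e he
    · intro e he
      rw [← hqc]
      exact hck e he
    · intro t B hts hlt htne htB hBcard
      exact ih t.card hlt t rfl B (h.mono hts) htne htB hBcard
  · refine .cactus s (h.isPrunedCactus hF hs hA hcard fun i hi => ?_)
    have := hrep ⟨i, hi⟩
    dsimp only at this
    rw [this, ← Finset.card_map (Function.Embedding.subtype (· ∈ s))]
    congr 2
    ext l
    simp [and_comm]

end Structure

end RainbowCycles

theorem theorem3 (n : ℕ) (hn : 1 ≤ n) (O : Fin n → Set (Sym2 (Fin (n + 1))))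
    (hO : ∀ i, RainbowCycles.IsCycleSet (O i)) :
    ¬ RainbowCycles.HasRainbowCycle O ↔ RainbowCycles.IsSaguaro O Finset.univ := by
  rw [RainbowCycles.not_hasRainbowCycle_iff hO]
  refine ⟨fun h => ?_, fun h => h.rainbowFree⟩
  have hfin : ∀ i, ∃ f : Finset (Sym2 (Fin (n + 1))), (f : Set (Sym2 (Fin (n + 1)))) = O i :=
    fun i => (O i).toFinite.exists_finset_coe
  choose F hFO using hfin
  obtain rfl : (fun i => (F i : Set (Sym2 (Fin (n + 1))))) = O := funext hFO
  exact RainbowCycles.RainbowFree.isSaguaro hO Finset.univ Finset.univ h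
    ⟨⟨0, hn⟩, Finset.mem_univ _⟩ (by simp) (by simp)
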